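/- Consider the following game (the max-distance network creation game). There are $n\ge 1$ agents, forming a finite set $V$, and a real number $\alpha>0$, the price of a link. A strategy of an agent $v$ is a subset $s_v\subseteq V\setminus\{v\}$. A strategy profile $s=(s_v)_{v\in V}$ creates the undirected graph $G_s$ on $V$ in which distinct $u,v$ are adjacent if and only if $u\in s_v$ or $v\in s_u$. The cost of agent $v$ is $$c_s(v)=\alpha\,|s_v|+\max_{u\in V} d_{G_s}(v,u),$$ where $d_{G_s}(v,u)$ is the length of a shortest path from $v$ to $u$ in $G_s$, and is $+\infty$ if there is no such path. The profile $s$ is a (pure) Nash equilibrium if $c_s(v)\le c_{s'}(v)$ for every agent $v$ and every profile $s'$ that differs from $s$ at most in the strategy of $v$. A graph $G$ on $V$ is an equilibrium graph if $G=G_s$ for some Nash equilibrium $s$. Theorem. If $\alpha>19$, then every equilibrium graph is a tree. -/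

import Mathlib

namespace MaxNCG

/-- A (pure) strategy of agent `v`: a set of agents, other than `v` itself, to which `v` builds
(and pays for) links. -/
abbrev Strategy (V : Type*) (v : V) : Type _ := {t : Finset V // v ∉ t}

/-- A strategy profile: one strategy for every agent. -/
abbrev Profile (V : Type*) : Type _ := (v : V) → Strategy V v

variable {V : Type*}

/-- The undirected graph created by a profile: `u` and `v` are adjacent when at least one of them
builds a link to the other. -/
def graph (s : Profile V) : SimpleGraph V where
  Adj u v := u ∈ (s v).1 ∨ v ∈ (s u).1
  symm := ⟨fun _ _ h => h.symm⟩
  loopless := ⟨fun v h => h.elim (s v).2 (s v).2⟩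

/-- The cost of agent `v`: `α` times the number of links it builds, plus the largest distance from
`v` to any agent, which is `⊤` when some agent is not reachable from `v`. -/
noncomputable def cost (α : ℝ) (s : Profile V) (v : V) : EReal :=
  ((α * ((s v).1.card : ℝ) : ℝ) : EReal) + (((graph s).eccent v : ENNReal) : EReal)

/-- A pure Nash equilibrium: no agent `v` can lower its own cost by passing to another profile `s'`
that differs from `s` only in the strategy of `v`. -/
def IsNashEquilibrium (α : ℝ) (s : Profile V) : Prop :=
  ∀ (v : V) (s' : Profile V), (∀ u, u ≠ v → s' u = s u) → cost α s v ≤ cost α s' v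

/-- An equilibrium graph is the graph created by some Nash equilibrium. -/
def IsEquilibriumGraph (α : ℝ) (G : SimpleGraph V) : Prop :=
  ∃ s : Profile V, IsNashEquilibrium α s ∧ graph s = G

end MaxNCG

/-!
Let `T` be a breadth-first search tree rooted at a center `r` of an equilibrium graph. An agent that
links itself to `r` gets an eccentricity at most one more than that of `r`, plus the length of the
detours around the links it drops at the same time. Comparing the equilibrium with such deviations
shows that a link outside `T` is owned by an agent `u` of depth at least `α`, that `u` has
eccentricity at most one more than `r`, and that no agent owns two links with short detours. The
latter makes every vertex on the path of length `k` from an owner `u` towards `r`, where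
`2 * k + 1 < α`, the owner of the link to its predecessor, so these paths are disjoint for different
owners `u`.

Suppose that some edge is not in `T`, and count at each vertex its branches: the edges that are
neither bridges nor lead to its parent. Over all vertices the branches in excess of the first are
fewer than the ends of the edges outside `T`, hence fewer than two per owner, so one of the paths
has at most one excess branch. Along an unbranched stretch of it the eccentricity decreases towards
`r`, since otherwise an agent would gain by linking past its successor on the path. For `k = 7` it
would drop below the eccentricity of the center `r`.
-/

namespace MaxNCG

open SimpleGraph Finset

section Distance

variable {V : Type*} {G H : SimpleGraph V}

theorem edist_le_edist_add_one {u x y : V} (h : G.Adj x y) : G.edist u y ≤ G.edist u x + 1 :=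
  SimpleGraph.edist_triangle.trans (add_le_add_right (edist_eq_one_iff_adj.2 h).le _)

theorem le_add_edist_of_forall_adj {φ : V → ℕ∞} (h : ∀ x y, G.Adj x y → φ y ≤ φ x + 1) (x y : V) :
    φ y ≤ φ x + G.edist x y := by
  have le_add_length {x y : V} (w : G.Walk x y) : φ y ≤ φ x + w.length := by
    induction w with
    | nil => simp
    | @cons x b y hxb w ih =>
      calc φ y ≤ φ b + w.length := ih
        _ ≤ φ x + 1 + w.length := by gcongr; exact h _ _ hxb
        _ = φ x + (Walk.cons hxb w).length := by rw [Walk.length_cons]; push_cast; ring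
  by_cases hr : G.Reachable x y
  · obtain ⟨w, hw⟩ := hr.exists_walk_length_eq_edist
    exact hw ▸ le_add_length w
  · simp [edist_eq_top_of_not_reachable hr]

theorem edist_le_edist_add_of_edist_le_add_one {u v : V} {k : ℕ}
    (hH : ∀ x y, G.Adj x y → s(x, y) ≠ s(u, v) → H.Adj x y) (huv : H.edist u v ≤ k + 1) (z : V) :
    H.edist u z ≤ G.edist u z + k := by
  have lipschitz (x y : V) (hxy : G.Adj x y) : H.edist u y - k ≤ H.edist u x - k + 1 := by
    rw [tsub_le_iff_right]
    by_cases he : s(x, y) = s(u, v)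
    · obtain ⟨rfl, rfl⟩ | ⟨rfl, rfl⟩ := Sym2.eq_iff.1 he
      · simpa [add_comm] using huv
      · simp
    · calc H.edist u y ≤ H.edist u x + 1 := edist_le_edist_add_one (hH x y hxy he)
        _ ≤ H.edist u x - k + k + 1 := by gcongr; exact le_tsub_add
        _ = H.edist u x - k + 1 + k := by ring
  simpa using tsub_le_iff_right.1 (le_add_edist_of_forall_adj lipschitz u z)

/-- A path from `A` spends one step before it leaves at `x`, and at least two, passing through `B`,
before it leaves at `y`; so the new edge `xy` wins a step in either case. -/
theorem edist_add_one_le_edist_of_exits {A B : Set V} {a x y z : V} (ha : a ∈ A)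
    (hzA : z ∉ A) (hzB : z ∉ B) (hA : ∀ p ∈ A, ∀ q, q ∉ A → q ∉ B → G.Adj p q → q = x)
    (hB : ∀ p ∈ B, ∀ q, q ∉ A → q ∉ B → G.Adj p q → q = y)
    (hH : ∀ p q, p ∉ A → q ∉ A → G.Adj p q → H.Adj p q) (hxy : H.Adj x y) :
    H.edist x z + 1 ≤ G.edist a z := by
  classical
  let φ (p : V) : ℕ∞ := if p ∈ A then 0 else if p ∈ B then 1 else H.edist x p + 1
  have lipschitz (p q : V) (hpq : G.Adj p q) : φ q ≤ φ p + 1 := by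
    by_cases hqA : q ∈ A
    · simp [φ, hqA]
    by_cases hqB : q ∈ B
    · simp [φ, hqA, hqB]
    by_cases hpA : p ∈ A
    · obtain rfl := hA p hpA q hqA hqB hpq
      simp [φ, hqA, hqB, hpA]
    by_cases hpB : p ∈ B
    · obtain rfl := hB p hpB q hqA hqB hpq
      simp [φ, hqA, hqB, hpA, hpB, edist_eq_one_iff_adj.2 hxy]
    simpa [φ, hqA, hqB, hpA, hpB] using
      add_le_add_left (edist_le_edist_add_one (hH p q hpA hqA hpq)) 1
  simpa [φ, ha, hzA, hzB] using le_add_edist_of_forall_adj lipschitz a z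

/-- The eccentricity as a natural number, so that it can be compared with a real price. It is
`0`, a junk value, when some vertex is not reachable. -/
noncomputable def natEccent (G : SimpleGraph V) (v : V) : ℕ := (G.eccent v).toNat

variable [Finite V]

theorem coe_natEccent (hG : G.Connected) (v : V) : (natEccent G v : ℕ∞) = G.eccent v := by
  have := hG.nonempty
  obtain ⟨z, hz⟩ := G.exists_edist_eq_eccent_of_finite v
  exact ENat.natCast_toNat (hz ▸ edist_ne_top_iff_reachable.2 (hG v z))

theorem edist_le_natEccent (hG : G.Connected) (v z : V) : G.edist v z ≤ natEccent G v :=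
  coe_natEccent hG v ▸ edist_le_eccent

theorem dist_le_natEccent (hG : G.Connected) (v z : V) : G.dist v z ≤ natEccent G v := by
  have h := edist_le_natEccent hG v z
  rw [← (hG v z).coe_dist_eq_edist] at h
  exact_mod_cast h

theorem natEccent_le_natEccent_add_one (hG : G.Connected) {x y : V} (h : G.Adj x y) :
    natEccent G x ≤ natEccent G y + 1 := by
  rw [← Nat.cast_le (α := ℕ∞), coe_natEccent hG, eccent_le_iff]
  intro z
  rw [SimpleGraph.edist_comm]
  calc G.edist z x ≤ G.edist z y + 1 := edist_le_edist_add_one h.symm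
    _ ≤ (natEccent G y + 1 : ℕ) := by
      push_cast
      gcongr
      exact SimpleGraph.edist_comm (G := G) ▸ edist_le_natEccent hG y z

theorem natEccent_le_of_mem_center (hG : G.Connected) {r : V} (hr : r ∈ G.center) (v : V) :
    natEccent G r ≤ natEccent G v := by
  rw [← Nat.cast_le (α := ℕ∞), coe_natEccent hG, coe_natEccent hG, (mem_center_iff r).1 hr]
  exact radius_le_eccent

end Distance

section Rewire

variable {V : Type*} {G : SimpleGraph V} {x a b : V} {R A : Set V}

/-- The graph obtained from `G` by deleting the edges from `x` to `R` and then joining `x` to `A`: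
the effect on the created graph when agent `x` gives up its links to `R` and buys links to `A`. -/
def rewire (G : SimpleGraph V) (x : V) (R A : Set V) : SimpleGraph V :=
  G.deleteEdges ((s(x, ·)) '' R) ⊔ fromRel fun a b => a = x ∧ b ∈ A

theorem rewire_adj_of_mem (hb : b ∈ A) (hxb : x ≠ b) : (rewire G x R A).Adj x b :=
  Or.inr ⟨hxb, Or.inl ⟨rfl, hb⟩⟩

theorem rewire_adj_of_forall_ne (h : G.Adj a b) (hab : ∀ y ∈ R, s(x, y) ≠ s(a, b)) :
    (rewire G x R A).Adj a b :=
  Or.inl (deleteEdges_adj.2 ⟨h, fun ⟨y, hy, hxy⟩ => hab y hy hxy⟩)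

theorem rewire_adj_of_ne (h : G.Adj a b) (ha : a ≠ x) (hb : b ≠ x) : (rewire G x R A).Adj a b :=
  rewire_adj_of_forall_ne h fun y _ hxy => by
    obtain ⟨hxa, -⟩ | ⟨hxb, -⟩ := Sym2.eq_iff.1 hxy
    exacts [ha hxa.symm, hb hxb.symm]

theorem rewire_adj_of_notMem (h : G.Adj a x) (ha : a ∉ R) : (rewire G x R A).Adj a x :=
  rewire_adj_of_forall_ne h fun y hy hxy => by
    obtain ⟨hxa, -⟩ | ⟨-, hya⟩ := Sym2.eq_iff.1 hxy
    exacts [h.ne hxa.symm, ha (hya ▸ hy)]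

end Rewire

section Game

variable {V : Type*} {α : ℝ} {s : Profile V} {x : V} {R A : Finset V} {m : ℕ}

theorem cost_le_of_edist_le (h : ∀ z, (graph s).edist x z ≤ m) :
    cost α s x ≤ ((α * #(s x).1 + m : ℝ) : EReal) := by
  have hecc : ((graph s).eccent x : ENNReal) ≤ (m : ENNReal) :=
    (ENat.toENNReal_le.2 ((eccent_le_iff x _).2 h)).trans_eq (ENat.toENNReal_coe m)
  rw [EReal.coe_add]
  exact add_le_add_right (EReal.coe_ennreal_le_coe_ennreal_iff.2 hecc |>.trans_eq <| by norm_cast) _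

theorem cost_eq_of_connected [Finite V] (hG : (graph s).Connected) (x : V) :
    cost α s x = ((α * #(s x).1 + natEccent (graph s) x : ℝ) : EReal) := by
  rw [cost, ← coe_natEccent hG, ENat.toENNReal_coe, EReal.coe_add]
  norm_cast

theorem eccent_ne_top_of_cost_ne_top (h : cost α s x ≠ ⊤) : (graph s).eccent x ≠ ⊤ := by
  intro htop
  exact h (by rw [cost, htop, ENat.toENNReal_top, EReal.coe_ennreal_top, EReal.coe_add_top])

theorem rewire_le_graph_update [DecidableEq V] (hx : x ∉ (s x).1 \ R ∪ A) :
    rewire (graph s) x R A ≤ graph (Function.update s x ⟨(s x).1 \ R ∪ A, hx⟩) := by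
  have buys (a b : V) (hab : b ∈ (s a).1) (hR : ∀ y ∈ R, s(x, y) ≠ s(a, b)) :
      b ∈ (Function.update s x ⟨(s x).1 \ R ∪ A, hx⟩ a).1 := by
    by_cases ha : a = x
    · subst ha
      have hb : b ∉ R := fun hb => hR b hb rfl
      simp [hab, hb]
    · simpa [Function.update_of_ne ha] using hab
  rintro a b (hab | ⟨-, ⟨rfl, hb⟩ | ⟨rfl, ha⟩⟩)
  · obtain ⟨hab, hR⟩ := deleteEdges_adj.1 hab
    replace hR (y : V) (hy : y ∈ R) : s(x, y) ≠ s(a, b) := fun h => hR ⟨y, hy, h⟩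
    exact hab.imp (fun h => buys b a h fun y hy => Sym2.eq_swap (a := a) ▸ hR y hy)
      fun h => buys a b h hR
  · exact Or.inr (by simpa using Or.inr hb)
  · exact Or.inl (by simpa using Or.inr ha)

theorem IsNashEquilibrium.cost_le_of_rewire [DecidableEq V] (hs : IsNashEquilibrium α s)
    (hxA : x ∉ A) (h : ∀ z, (rewire (graph s) x R A).edist x z ≤ m) :
    cost α s x ≤ ((α * #((s x).1 \ R ∪ A) + m : ℝ) : EReal) := by
  have hx : x ∉ (s x).1 \ R ∪ A := by simp [hxA, (s x).2]
  refine (hs x _ fun u hu => Function.update_of_ne hu ⟨_, hx⟩ s).trans ?_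
  refine (cost_le_of_edist_le (m := m) fun z => ?_).trans_eq (by rw [Function.update_self])
  exact (edist_anti (rewire_le_graph_update hx)).trans (h z)

theorem IsNashEquilibrium.connected [Finite V] [Nonempty V] (hs : IsNashEquilibrium α s) :
    (graph s).Connected := by
  classical
  have := Fintype.ofFinite V
  obtain ⟨v⟩ := ‹Nonempty V›
  have near (z : V) : (rewire (graph s) v (∅ : Finset V) (univ.erase v : Finset V)).edist v z ≤
      (1 : ℕ) := by
    by_cases hz : v = z
    · simp [hz]
    · exact (edist_eq_one_iff_adj.2 (rewire_adj_of_mem (by simp [Ne.symm hz]) hz)).le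
  have hcost := (hs.cost_le_of_rewire (by simp) near).trans_lt (EReal.coe_lt_top _)
  by_contra hG
  exact eccent_ne_top_of_cost_ne_top hcost.ne (eccent_eq_top_of_not_connected hG v)

theorem IsNashEquilibrium.le_of_rewire [Finite V] (hs : IsNashEquilibrium α s) (hα : 0 ≤ α)
    (hR : R ⊆ (s x).1) (hxA : x ∉ A) (h : ∀ z, (rewire (graph s) x R A).edist x z ≤ m) :
    α * #R + natEccent (graph s) x ≤ α * #A + m := by
  classical
  have : Nonempty V := ⟨x⟩
  have hcost := hs.cost_le_of_rewire hxA h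
  rw [cost_eq_of_connected hs.connected, EReal.coe_le_coe_iff] at hcost
  have hcard : (#((s x).1 \ R ∪ A) + #R : ℝ) ≤ #A + #(s x).1 := by
    have := card_union_le ((s x).1 \ R) A
    have := card_sdiff_add_card_eq_card hR
    exact_mod_cast (by omega : #((s x).1 \ R ∪ A) + #R ≤ #A + #(s x).1)
  linarith [mul_le_mul_of_nonneg_left hcard hα]

end Game

/-- A breadth-first search tree of `G`, given by its root and the parent function, which fixes the
root. -/
structure BFSTree {V : Type*} (G : SimpleGraph V) where
  root : V
  par : V → V
  par_root : par root = root
  adj_par : ∀ x, x ≠ root → G.Adj x (par x)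
  dist_par : ∀ x, x ≠ root → G.dist root x = G.dist root (par x) + 1

namespace BFSTree

section Tree

variable {V : Type*} {G : SimpleGraph V} {T : BFSTree G} {a b c x y z : V} {k : ℕ}

theorem exists_root_eq (hG : G.Connected) (r : V) : ∃ T : BFSTree G, T.root = r := by
  have exists_parent (x : V) :
      ∃ y, (x = r → y = r) ∧ (x ≠ r → G.Adj x y ∧ G.dist r x = G.dist r y + 1) := by
    by_cases hx : x = r
    · exact ⟨r, fun _ => rfl, fun h => absurd hx h⟩
    obtain ⟨w, hw⟩ := hG.exists_walk_length_eq_dist x r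
    cases w with
    | nil => exact absurd rfl hx
    | @cons _ y _ hxy w =>
      refine ⟨y, fun h => absurd h hx, fun _ => ⟨hxy, ?_⟩⟩
      have hle : G.dist r x ≤ G.dist r y + G.dist y x := hG.dist_triangle
      have hge := dist_le w
      rw [dist_eq_one_iff_adj.2 hxy.symm] at hle
      rw [Walk.length_cons] at hw
      rw [SimpleGraph.dist_comm] at hw hge
      omega
  choose f hf using exists_parent
  exact ⟨⟨r, f, (hf r).1 rfl, fun x hx => ((hf x).2 hx).1, fun x hx => ((hf x).2 hx).2⟩, rfl⟩

/-- The depth of a vertex: its distance from the root. -/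
noncomputable def depth (T : BFSTree G) (x : V) : ℕ := G.dist T.root x

/-- `T.IsAncestor c z` says that `c` is an ancestor of `z`, possibly `z` itself. -/
def IsAncestor (T : BFSTree G) (c z : V) : Prop := ∃ k ≤ T.depth z, T.par^[k] z = c

theorem depth_root : T.depth T.root = 0 := SimpleGraph.dist_self

theorem depth_eq (hx : x ≠ T.root) : T.depth x = T.depth (T.par x) + 1 := T.dist_par x hx

theorem depth_par (x : V) : T.depth (T.par x) = T.depth x - 1 := by
  by_cases hx : x = T.root
  · rw [hx, T.par_root, depth_root]
  · rw [depth_eq hx, Nat.add_sub_cancel]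

theorem depth_iterate (k : ℕ) (x : V) : T.depth (T.par^[k] x) = T.depth x - k := by
  induction k with
  | zero => rfl
  | succ k ih => rw [Function.iterate_succ_apply', depth_par, ih, Nat.sub_sub]

theorem ne_root_of_depth_pos (h : 0 < T.depth x) : x ≠ T.root := by
  rintro rfl
  exact h.ne' depth_root

theorem eq_root_of_depth_eq_zero (h : T.depth x = 0) : x = T.root := by
  by_contra hx
  rw [depth_eq hx] at h
  exact Nat.succ_ne_zero _ h

theorem depth_le_depth_add_one (h : G.Adj x y) : T.depth y ≤ T.depth x + 1 := by
  rcases h.diff_dist_adj (u := T.root) with h | h | h <;> unfold depth <;> omega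

namespace IsAncestor

theorem refl (x : V) : T.IsAncestor x x := ⟨0, Nat.zero_le _, rfl⟩

theorem trans (hab : T.IsAncestor a b) (hbc : T.IsAncestor b c) : T.IsAncestor a c := by
  obtain ⟨k, hk, rfl⟩ := hab
  obtain ⟨l, hl, rfl⟩ := hbc
  rw [depth_iterate] at hk
  exact ⟨k + l, by omega, Function.iterate_add_apply _ _ _ _⟩

theorem iterate (h : k ≤ T.depth z) : T.IsAncestor (T.par^[k] z) z := ⟨k, h, rfl⟩

theorem par (hz : z ≠ T.root) : T.IsAncestor (T.par z) z := ⟨1, by rw [depth_eq hz]; omega, rfl⟩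

theorem root (z : V) : T.IsAncestor T.root z :=
  ⟨T.depth z, le_rfl, eq_root_of_depth_eq_zero (by rw [depth_iterate, Nat.sub_self])⟩

theorem depth_le (h : T.IsAncestor c z) : T.depth c ≤ T.depth z := by
  obtain ⟨k, -, rfl⟩ := h
  exact depth_iterate k z ▸ Nat.sub_le _ _

theorem eq_of_depth_le (h : T.IsAncestor c z) (hcz : T.depth z ≤ T.depth c) : z = c := by
  obtain ⟨k, hk, rfl⟩ := h
  rw [depth_iterate] at hcz
  obtain rfl : k = 0 := by omega
  rfl

theorem ne_root (h : T.IsAncestor c z) (hzc : z ≠ c) : z ≠ T.root := by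
  rintro rfl
  exact hzc (h.eq_of_depth_le (depth_root.trans_le (Nat.zero_le _)))

theorem of_ne (h : T.IsAncestor c z) (hzc : z ≠ c) : T.IsAncestor c (T.par z) := by
  obtain ⟨_ | k, hk, rfl⟩ := h
  · exact absurd rfl hzc
  · exact ⟨k, by rw [depth_par]; omega, rfl⟩

theorem exists_child (h : T.IsAncestor c z) (hzc : z ≠ c) :
    ∃ y, T.par y = c ∧ T.IsAncestor c y ∧ T.IsAncestor y z := by
  obtain ⟨_ | k, hk, rfl⟩ := h
  · exact absurd rfl hzc
  · rw [Function.iterate_succ_apply']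
    refine ⟨T.par^[k] z, rfl, par (ne_root_of_depth_pos ?_), iterate (by omega)⟩
    rw [depth_iterate]
    omega

theorem edist_le {H : SimpleGraph V} (h : T.IsAncestor c z)
    (hH : ∀ w, T.IsAncestor c w → T.IsAncestor w z → w ≠ c → H.Adj w (T.par w)) :
    H.edist z c ≤ (T.depth z - T.depth c : ℕ) := by
  induction hn : T.depth z - T.depth c generalizing z with
  | zero => simp [h.eq_of_depth_le (by omega)]
  | succ n ih =>
    have hzc : z ≠ c := by rintro rfl; omega
    have hz := h.ne_root hzc
    rw [SimpleGraph.edist_comm]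
    calc H.edist c z ≤ H.edist c (T.par z) + 1 :=
          edist_le_edist_add_one (hH z h (refl z) hzc).symm
      _ ≤ n + 1 := by
        rw [SimpleGraph.edist_comm]
        gcongr
        exact ih (h.of_ne hzc) (fun w hcw hw => hH w hcw (hw.trans (par hz)))
          (by rw [depth_par]; omega)
      _ = (n + 1 : ℕ) := by push_cast; rfl

end IsAncestor

theorem connected (T : BFSTree G) : G.Connected := by
  have reachable_root (z : V) : G.Reachable z T.root := by
    rw [← edist_ne_top_iff_reachable]
    exact ne_top_of_le_ne_top (ENat.natCast_ne_top _) ((IsAncestor.root z).edist_le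
      fun w _ _ hw => T.adj_par w hw)
  exact (connected_iff _).2 ⟨fun a b => (reachable_root a).trans (reachable_root b).symm, ⟨T.root⟩⟩

theorem depth_le_natEccent [Finite V] (T : BFSTree G) (z : V) : T.depth z ≤ natEccent G T.root :=
  dist_le_natEccent T.connected _ _

/-- `T.Cross x y` says that `xy` is an edge of the graph but not of the tree. -/
def Cross (T : BFSTree G) (x y : V) : Prop := G.Adj x y ∧ T.par x ≠ y ∧ T.par y ≠ x

theorem Cross.symm (h : T.Cross x y) : T.Cross y x := ⟨h.1.symm, h.2.2, h.2.1⟩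

theorem isTree_of_forall_not_cross [Finite V] (h : ∀ x y, ¬ T.Cross x y) : G.IsTree := by
  have edgeSet_subset : G.edgeSet ⊆ (fun z => s(z, T.par z)) '' {T.root}ᶜ := by
    intro e
    induction e using Sym2.ind with
    | _ x y =>
      intro hxy
      have mem_image {x y : V} (hxy : G.Adj x y) (hy : T.par x = y) :
          s(x, y) ∈ (fun z => s(z, T.par z)) '' {T.root}ᶜ := by
        refine ⟨x, ?_, hy ▸ rfl⟩
        rintro rfl
        exact hxy.ne (T.par_root.symm.trans hy)
      by_cases hx : T.par x = y
      · exact mem_image hxy hx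
      by_cases hy : T.par y = x
      · exact Sym2.eq_swap (a := x) ▸ mem_image (adj_symm _ hxy) hy
      · exact absurd ⟨hxy, hx, hy⟩ (h x y)
  have ncard_edgeSet_le : G.edgeSet.ncard ≤ ({T.root}ᶜ : Set V).ncard :=
    (Set.ncard_le_ncard edgeSet_subset (Set.toFinite _)).trans
      (Set.ncard_image_le (Set.toFinite _))
  have ncard_compl_add_one := Set.ncard_add_ncard_compl {T.root}
  rw [Set.ncard_singleton] at ncard_compl_add_one
  rw [isTree_iff_connected_and_card, Nat.card_coe_set_eq]
  refine ⟨T.connected, le_antisymm (by omega) ?_⟩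
  simpa only [Nat.card_coe_set_eq] using T.connected.card_vert_le_card_edgeSet_add_one

/-- `T.IsBypassed c` says that the edge from `c` to its parent is not a bridge: some edge outside
the tree also leaves the subtree of `c`. -/
def IsBypassed (T : BFSTree G) (c : V) : Prop :=
  ∃ a b, T.Cross a b ∧ T.IsAncestor c a ∧ ¬ T.IsAncestor c b

theorem IsBypassed.ne_root (h : T.IsBypassed c) : c ≠ T.root := by
  rintro rfl
  obtain ⟨a, b, -, -, hb⟩ := h
  exact hb (IsAncestor.root b)

theorem eq_and_eq_par_of_not_isBypassed (hb : ¬ T.IsBypassed b) (h : G.Adj x y)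
    (hx : T.IsAncestor b x) (hy : ¬ T.IsAncestor b y) : x = b ∧ y = T.par b := by
  by_cases hxy : T.par x = y
  · obtain rfl : x = b := by
      by_contra hxb
      exact hy (hxy ▸ hx.of_ne hxb)
    exact ⟨rfl, hxy.symm⟩
  by_cases hyx : T.par y = x
  · have hyr : y ≠ T.root := by
      rintro rfl
      exact h.ne (hyx.symm.trans T.par_root)
    exact absurd ((hyx ▸ hx).trans (IsAncestor.par hyr)) hy
  · exact absurd ⟨x, y, ⟨h, hxy, hyx⟩, hx, hy⟩ hb

/-- The vertices that hang at `x` on bridges of the tree, together with `x` itself. -/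
def pendant (T : BFSTree G) (x : V) : Set V :=
  {z | z = x ∨ ∃ b, b ≠ T.root ∧ T.par b = x ∧ ¬ T.IsBypassed b ∧ T.IsAncestor b z}

theorem self_mem_pendant (x : V) : x ∈ T.pendant x := Or.inl rfl

theorem isAncestor_of_mem_pendant (h : z ∈ T.pendant x) : T.IsAncestor x z := by
  obtain rfl | ⟨b, hb, rfl, -, hz⟩ := h
  exacts [.refl z, (IsAncestor.par hb).trans hz]

end Tree

section Branches

variable {V : Type*} [Fintype V] {G : SimpleGraph V} {T : BFSTree G} {x y z : V}

open Classical in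
/-- The neighbours of `x`, apart from its parent, that are joined to `x` by an edge which is not a
bridge: the children of `x` on bypassed edges, and the ends of the edges outside the tree. -/
noncomputable def branches (T : BFSTree G) (x : V) : Finset V :=
  {y | (T.IsBypassed y ∧ T.par y = x) ∨ T.Cross x y}

theorem mem_branches : y ∈ T.branches x ↔ (T.IsBypassed y ∧ T.par y = x) ∨ T.Cross x y := by
  simp [branches]

theorem adj_of_mem_branches (h : y ∈ T.branches x) : G.Adj x y := by
  obtain ⟨hy, rfl⟩ | hxy := mem_branches.1 h
  exacts [(T.adj_par y hy.ne_root).symm, hxy.1]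

theorem IsBypassed.branches_nonempty (h : T.IsBypassed x) : (T.branches x).Nonempty := by
  obtain ⟨a, b, hab, ha, hb⟩ := h
  obtain rfl | hax := eq_or_ne a x
  · exact ⟨b, mem_branches.2 (Or.inr hab)⟩
  · obtain ⟨y, hy, hxy, hya⟩ := ha.exists_child hax
    exact ⟨y, mem_branches.2 (Or.inl ⟨⟨a, b, hab, hya, fun h => hb (hxy.trans h)⟩, hy⟩)⟩

theorem eq_par_or_mem_branches_of_exits_pendant (h : G.Adj y z) (hy : y ∈ T.pendant x)
    (hz : z ∉ T.pendant x) : z = T.par x ∨ z ∈ T.branches x := by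
  obtain rfl | ⟨b, hb, rfl, hbb, hby⟩ := hy
  · by_contra! hcon
    have hzy : T.par z = y := by
      by_contra hzy
      exact hcon.2 (mem_branches.2 (Or.inr ⟨h, hcon.1.symm, hzy⟩))
    have hzr : z ≠ T.root := by
      rintro rfl
      exact h.ne (hzy.symm.trans T.par_root)
    exact hz (Or.inr ⟨z, hzr, hzy, fun hzb => hcon.2 (mem_branches.2 (Or.inl ⟨hzb, hzy⟩)), .refl z⟩)
  · have hbz : ¬ T.IsAncestor b z := fun hbz => hz (Or.inr ⟨b, hb, rfl, hbb, hbz⟩)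
    obtain ⟨-, rfl⟩ := eq_and_eq_par_of_not_isBypassed hbb h hby hbz
    exact absurd (self_mem_pendant _) hz

theorem exists_not_isBypassed_branches_nonempty (h : T.Cross x y) :
    ∃ z, ¬ T.IsBypassed z ∧ (T.branches z).Nonempty := by
  classical
  obtain ⟨z, hz, hmin⟩ := exists_min_image {z | (T.branches z).Nonempty} T.depth
    ⟨x, by simpa using ⟨y, mem_branches.2 (Or.inr h)⟩⟩
  refine ⟨z, fun hzb => ?_, by simpa using hz⟩
  have hle := hmin (T.par z) (by simpa using ⟨z, mem_branches.2 (Or.inl ⟨hzb, rfl⟩)⟩)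
  rw [depth_eq hzb.ne_root] at hle
  omega

open Classical in
theorem sum_card_branches_le :
    ∑ x, #(T.branches x) ≤ #{x | T.IsBypassed x} + ∑ x, #{y | T.Cross x y} := by
  rw [card_eq_sum_card_fiberwise (f := T.par) (t := univ) (by simp), ← sum_add_distrib]
  gcongr with x
  rw [branches, filter_or, filter_filter]
  exact card_union_le _ _

open Classical in
theorem sum_card_branches_sub_one_lt (h : T.Cross x y) :
    ∑ x with T.IsBypassed x, (#(T.branches x) - 1) < ∑ x, #{y | T.Cross x y} := by
  obtain ⟨z, hz, hbr⟩ := exists_not_isBypassed_branches_nonempty h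
  have hsub : ∑ x with T.IsBypassed x, (#(T.branches x) - 1) + #{x | T.IsBypassed x} =
      ∑ x with T.IsBypassed x, #(T.branches x) := by
    rw [card_eq_sum_ones, ← sum_add_distrib]
    refine sum_congr rfl fun x hx => Nat.sub_add_cancel ?_
    exact (mem_filter.1 hx).2.branches_nonempty.card_pos
  have hlt : ∑ x with T.IsBypassed x, #(T.branches x) < ∑ x, #(T.branches x) :=
    sum_lt_sum_of_subset (filter_subset _ _) (mem_univ z) (by simpa using hz) hbr.card_pos
      fun _ _ _ => Nat.zero_le _
  have := T.sum_card_branches_le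
  omega

end Branches

section Detour

variable {V : Type*} {G : SimpleGraph V} {T : BFSTree G} {u v w x y z : V} {R A : Set V} {k : ℕ}

theorem Cross.rewire_adj_par (h : T.Cross u v) (hw : w ≠ T.root) :
    (rewire G u {v} A).Adj w (T.par w) := by
  refine rewire_adj_of_forall_ne (T.adj_par w hw) fun y hy heq => ?_
  obtain rfl : y = v := hy
  obtain ⟨rfl, hv⟩ | ⟨hu, rfl⟩ := Sym2.eq_iff.1 heq
  exacts [h.2.1 hv.symm, h.2.2 hu.symm]

theorem IsAncestor.edist_rewire_le (h : T.IsAncestor y z) (hxy : T.depth x < T.depth y) :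
    (rewire G x R A).edist z y ≤ (T.depth z - T.depth y : ℕ) := by
  have ne_of_isAncestor {w : V} (hw : T.IsAncestor y w) : w ≠ x := by
    rintro rfl
    exact hxy.not_ge hw.depth_le
  exact h.edist_le fun w hyw _ hwy => rewire_adj_of_ne (T.adj_par w (hyw.ne_root hwy))
    (ne_of_isAncestor hyw) (ne_of_isAncestor (hyw.of_ne hwy))

theorem edist_rewire_root_le (hx : x ≠ T.root)
    (hz : ∀ y ∈ R, T.par y = x → ¬ T.IsAncestor y z) :
    (rewire G x R {T.root}).edist x z ≤ (T.depth z + 1 : ℕ) := by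
  rw [SimpleGraph.edist_comm]
  by_cases hxz : T.IsAncestor x z
  · refine (hxz.edist_le fun w hxw hwz hwx => ?_).trans (by exact_mod_cast (by omega))
    have hadj := T.adj_par w (hxw.ne_root hwx)
    by_cases hw : T.par w = x
    · rw [hw] at hadj ⊢
      exact rewire_adj_of_notMem hadj fun hwR => hz w hwR hw hwz
    · exact rewire_adj_of_ne hadj hwx hw
  · have hroot : (rewire G x R {T.root}).edist z T.root ≤ (T.depth z - T.depth T.root : ℕ) := by
      refine (IsAncestor.root z).edist_le fun w _ hwz hw => ?_
      refine rewire_adj_of_ne (T.adj_par w hw) ?_ ?_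
      · rintro rfl
        exact hxz hwz
      · rintro rfl
        exact hxz ((IsAncestor.par hw).trans hwz)
    rw [depth_root, Nat.sub_zero] at hroot
    have hadj : (rewire G x R {T.root}).Adj x T.root := rewire_adj_of_mem rfl hx
    push_cast
    exact (edist_le_edist_add_one hadj.symm).trans (by gcongr)

theorem edist_rewire_root_le_of_adj (hx : x ≠ T.root) (hy : T.par y = x) (hyu : T.IsAncestor y u)
    (huv : G.Adj u v) (hxv : ¬ T.IsAncestor x v) (hyz : T.IsAncestor y z) :
    (rewire G x R {T.root}).edist x z ≤
      (T.depth z + 2 * (T.depth u - T.depth y) + 3 : ℕ) := by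
  have ne_root {y : V} (hy : T.par y = x) : y ≠ T.root := by
    rintro rfl
    exact hx (hy.symm.trans T.par_root)
  have hxy : T.depth y = T.depth x + 1 := hy ▸ depth_eq (ne_root hy)
  have edist_v := edist_rewire_root_le (R := R) hx fun y' _ hy' hv =>
    hxv (hy' ▸ (IsAncestor.par (ne_root hy')).trans hv)
  have adj_vu : (rewire G x R {T.root}).Adj v u := by
    refine rewire_adj_of_ne huv.symm ?_ ?_
    · rintro rfl
      exact hxv (.refl v)
    · rintro rfl
      exact absurd hyu.depth_le (by omega)
  have edist_uy := hyu.edist_rewire_le (R := R) (A := {T.root}) (x := x) (by omega)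
  have edist_zy := hyz.edist_rewire_le (R := R) (A := {T.root}) (x := x) (by omega)
  rw [SimpleGraph.edist_comm] at edist_zy
  have hvu := T.depth_le_depth_add_one huv
  have hyu_le := hyu.depth_le
  have hyz_le := hyz.depth_le
  generalize rewire G x R {T.root} = H at *
  calc H.edist x z ≤ H.edist x u + H.edist u z := SimpleGraph.edist_triangle
    _ ≤ (H.edist x v + 1) + (H.edist u y + H.edist y z) := by
      gcongr
      exacts [edist_le_edist_add_one adj_vu, SimpleGraph.edist_triangle]
    _ ≤ ((T.depth v + 1 : ℕ) + 1) +
        ((T.depth u - T.depth y : ℕ) + (T.depth z - T.depth y : ℕ)) := by gcongr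
    _ ≤ _ := by exact_mod_cast (by omega)

/-- If `y` is a child of `x`, then an edge that starts in the subtree of `y`, less than `k` levels
below `y`, leaves the subtree of `x`. So `x` can drop its link to `y` and, being linked to the
root, still reach the subtree of `y` along that edge. -/
def HasDetour (T : BFSTree G) (k : ℕ) (x y : V) : Prop :=
  T.par y = x → ∃ u v, T.IsAncestor y u ∧ G.Adj u v ∧ ¬ T.IsAncestor x v ∧ T.depth u < T.depth y + k

theorem HasDetour.of_par_ne (h : T.par y ≠ x) : T.HasDetour k x y := fun hy => absurd hy h

theorem edist_rewire_root_le_of_hasDetour (hx : x ≠ T.root) (hR : ∀ y ∈ R, T.HasDetour k x y)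
    (z : V) : (rewire G x R {T.root}).edist x z ≤ (T.depth z + 2 * k + 1 : ℕ) := by
  by_cases hz : ∀ y ∈ R, T.par y = x → ¬ T.IsAncestor y z
  · exact (edist_rewire_root_le hx hz).trans (by exact_mod_cast (by omega))
  · push Not at hz
    obtain ⟨y, hyR, hy, hyz⟩ := hz
    obtain ⟨u, v, hyu, huv, hxv, hk⟩ := hR y hyR hy
    refine (edist_rewire_root_le_of_adj hx hy hyu huv hxv hyz).trans ?_
    have := hyu.depth_le
    exact_mod_cast (by omega)

end Detour

end BFSTree

open BFSTree

namespace IsNashEquilibrium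

variable {V : Type*} [Finite V] {α : ℝ} {s : Profile V} {T : BFSTree (graph s)} {x a b : V} {k : ℕ}

theorem le_of_hasDetour (hs : IsNashEquilibrium α s) (hα : 0 ≤ α) (hx : x ≠ T.root)
    {R : Finset V} (hR : R ⊆ (s x).1) (hdet : ∀ y ∈ R, T.HasDetour k x y) :
    α * #R + natEccent (graph s) x ≤ α + (natEccent (graph s) T.root + 2 * k + 1) := by
  have hle := hs.le_of_rewire hα hR (A := {T.root}) (by simpa using hx)
    (m := natEccent (graph s) T.root + 2 * k + 1) fun z => by
      rw [coe_singleton]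
      refine (edist_rewire_root_le_of_hasDetour hx hdet z).trans ?_
      gcongr
      exact T.depth_le_natEccent z
  simpa using hle

theorem eq_of_hasDetour (hs : IsNashEquilibrium α s) (hT : T.root ∈ (graph s).center)
    (hk : 2 * k + 1 < α) (hx : x ≠ T.root) (ha : a ∈ (s x).1) (hb : b ∈ (s x).1)
    (hdeta : T.HasDetour k x a) (hdetb : T.HasDetour k x b) : a = b := by
  classical
  by_contra hab
  -- Trading both links for one to the root would save `α` and cost at most `2 * k + 1`.
  have hle := hs.le_of_hasDetour (R := {a, b}) (by linarith [k.cast_nonneg (α := ℝ)]) hx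
    (by simp [insert_subset_iff, ha, hb]) (k := k) (by simp [hdeta, hdetb])
  have hcenter : (natEccent (graph s) T.root : ℝ) ≤ natEccent (graph s) x := by
    exact_mod_cast natEccent_le_of_mem_center T.connected hT x
  rw [card_pair hab] at hle
  push_cast at hle
  linarith

end IsNashEquilibrium

/-- A link outside the tree, listed with its owner `u` first. -/
def CrossLink {V : Type*} {s : Profile V} (T : BFSTree (graph s)) (u v : V) : Prop :=
  T.Cross u v ∧ v ∈ (s u).1

namespace CrossLink

section Price

variable {V : Type*} [Finite V] {α : ℝ} {s : Profile V} {T : BFSTree (graph s)} {u v : V} {j : ℕ}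

theorem le_depth (h : CrossLink T u v) (hs : IsNashEquilibrium α s) (hα : 0 ≤ α)
    (hT : T.root ∈ (graph s).center) : α ≤ T.depth u := by
  have edist_root (z : V) : (rewire (graph s) u {v} ∅).edist z T.root ≤ T.depth z := by
    simpa [depth_root] using (IsAncestor.root z).edist_le fun w _ _ hw => h.1.rewire_adj_par hw
  have hle := hs.le_of_rewire hα (R := {v}) (A := ∅) (m := T.depth u + natEccent (graph s) T.root)
    (by simpa using h.2) (by simp) fun z => by
      rw [coe_singleton, coe_empty]
      calc (rewire (graph s) u {v} ∅).edist u z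
          ≤ (rewire (graph s) u {v} ∅).edist u T.root +
            (rewire (graph s) u {v} ∅).edist T.root z := SimpleGraph.edist_triangle
        _ ≤ T.depth u + T.depth z := by
          rw [SimpleGraph.edist_comm (u := T.root)]
          gcongr <;> exact edist_root _
        _ ≤ _ := by
          push_cast
          gcongr
          exact T.depth_le_natEccent z
  have hcenter : (natEccent (graph s) T.root : ℝ) ≤ natEccent (graph s) u := by
    exact_mod_cast natEccent_le_of_mem_center T.connected hT u
  simp only [card_singleton, card_empty, Nat.cast_one, Nat.cast_zero, Nat.cast_add] at hle
  linarith

theorem ne_root (h : CrossLink T u v) (hs : IsNashEquilibrium α s) (hα : 0 < α)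
    (hT : T.root ∈ (graph s).center) : u ≠ T.root :=
  ne_root_of_depth_pos (by exact_mod_cast hα.trans_le (h.le_depth hs hα.le hT))

theorem natEccent_le (h : CrossLink T u v) (hs : IsNashEquilibrium α s) (hα : 0 < α)
    (hT : T.root ∈ (graph s).center) :
    natEccent (graph s) u ≤ natEccent (graph s) T.root + 1 := by
  have hle := hs.le_of_hasDetour hα.le (h.ne_root hs hα hT) (R := {v}) (k := 0)
    (by simpa using h.2) (by simpa using HasDetour.of_par_ne h.1.2.2)
  rw [← Nat.cast_le (α := ℝ)]
  push_cast
  simp only [card_singleton, Nat.cast_one, Nat.cast_zero] at hle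
  linarith

theorem not_isAncestor_iterate_of_lt (h : CrossLink T u v) (hs : IsNashEquilibrium α s)
    (hju : j ≤ T.depth u) (hj : 2 * j < α) : ¬ T.IsAncestor (T.par^[j] u) v := by
  intro hv
  have edist_iterate {z : V} (hz : T.IsAncestor (T.par^[j] u) z) :
      (rewire (graph s) u {v} ∅).edist z (T.par^[j] u) ≤
        (T.depth z - T.depth (T.par^[j] u) : ℕ) :=
    hz.edist_le fun w hw _ hne => h.1.rewire_adj_par (hw.ne_root hne)
  have edist_uv : (rewire (graph s) u {v} ∅).edist u v ≤ (2 * j : ℕ) + 1 := by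
    have huv := T.depth_le_depth_add_one h.1.1
    calc (rewire (graph s) u {v} ∅).edist u v
        ≤ (rewire (graph s) u {v} ∅).edist u (T.par^[j] u) +
          (rewire (graph s) u {v} ∅).edist v (T.par^[j] u) := by
          rw [SimpleGraph.edist_comm (u := v)]
          exact SimpleGraph.edist_triangle
      _ ≤ (T.depth u - T.depth (T.par^[j] u) : ℕ) + (T.depth v - T.depth (T.par^[j] u) : ℕ) :=
        add_le_add (edist_iterate (.iterate hju)) (edist_iterate hv)
      _ ≤ _ := by
        rw [depth_iterate]
        exact_mod_cast (by omega)
  have hle := hs.le_of_rewire (R := {v}) (A := ∅) (m := natEccent (graph s) u + 2 * j)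
    (by linarith [j.cast_nonneg (α := ℝ)]) (by simpa using h.2) (by simp) fun z => by
      rw [coe_singleton, coe_empty]
      refine (edist_le_edist_add_of_edist_le_add_one (G := graph s) ?_ edist_uv z).trans ?_
      · refine fun x y hxy hne => rewire_adj_of_forall_ne hxy fun w hw => ?_
        exact Set.mem_singleton_iff.1 hw ▸ hne.symm
      · push_cast
        gcongr
        exact edist_le_natEccent T.connected u z
  simp only [card_singleton, card_empty, Nat.cast_one, Nat.cast_zero] at hle
  push_cast at hle
  linarith

end Price

section Paths

variable {V : Type*} [Finite V] {α : ℝ} {s : Profile V} {T : BFSTree (graph s)} {u v u' v' : V}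
  {i j k : ℕ}

variable (h : CrossLink T u v) (hs : IsNashEquilibrium α s) (hk : 2 * k + 1 < α)
  (hT : T.root ∈ (graph s).center)
include h hs hk hT

theorem lt_depth : 2 * k + 1 < T.depth u := by
  exact_mod_cast hk.trans_le (h.le_depth hs (by linarith [k.cast_nonneg (α := ℝ)]) hT)

theorem iterate_ne_root (hj : j ≤ 2 * k + 1) : T.par^[j] u ≠ T.root :=
  ne_root_of_depth_pos (by rw [depth_iterate]; have := h.lt_depth hs hk hT; omega)

theorem iterate_ne_iterate (hj : j ≤ 2 * k + 1) (hij : i ≠ j) : T.par^[i] u ≠ T.par^[j] u := by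
  intro heq
  have hd := congrArg T.depth heq
  rw [depth_iterate, depth_iterate] at hd
  have := h.lt_depth hs hk hT
  omega

theorem not_isAncestor_iterate (hj : j ≤ k) : ¬ T.IsAncestor (T.par^[j] u) v := by
  have hjk : (j : ℝ) ≤ k := by exact_mod_cast hj
  have := h.lt_depth hs hk hT
  exact h.not_isAncestor_iterate_of_lt hs (by omega) (by linarith)

theorem isBypassed_iterate (hj : j ≤ k) : T.IsBypassed (T.par^[j] u) :=
  ⟨u, v, h.1, .iterate (by have := h.lt_depth hs hk hT; omega),
    h.not_isAncestor_iterate hs hk hT hj⟩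

theorem adj_iterate (hj : j ≤ 2 * k + 1) : (graph s).Adj (T.par^[j] u) (T.par^[j + 1] u) := by
  rw [Function.iterate_succ_apply']
  exact T.adj_par _ (h.iterate_ne_root hs hk hT hj)

theorem hasDetour_iterate (hj : j < k) : T.HasDetour k (T.par^[j + 1] u) (T.par^[j] u) := by
  have := h.lt_depth hs hk hT
  refine fun _ => ⟨u, v, .iterate (by omega), h.1.1, h.not_isAncestor_iterate hs hk hT hj, ?_⟩
  rw [depth_iterate]
  omega

theorem eq_of_owner_eq (h' : CrossLink T u v') : v = v' :=
  hs.eq_of_hasDetour hT hk (h.iterate_ne_root hs hk hT (Nat.zero_le _)) h.2 h'.2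
    (.of_par_ne h.1.2.2) (.of_par_ne h'.1.2.2)

theorem iterate_succ_notMem (hj : j ≤ k) : T.par^[j + 1] u ∉ (s (T.par^[j] u)).1 := by
  have hasDetour_par (j : ℕ) (hj : j ≤ k) : T.HasDetour k (T.par^[j] u) (T.par^[j + 1] u) := by
    refine .of_par_ne ?_
    rw [← Function.iterate_succ_apply' T.par]
    exact h.iterate_ne_iterate hs hk hT (by omega) (by omega)
  intro hmem
  induction j with
  | zero =>
    exact h.1.2.1 (hs.eq_of_hasDetour hT hk (h.iterate_ne_root hs hk hT (Nat.zero_le _)) hmem h.2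
      (hasDetour_par 0 hj) (.of_par_ne h.1.2.2))
  | succ j ih =>
    have hown : T.par^[j] u ∈ (s (T.par^[j + 1] u)).1 :=
      (h.adj_iterate hs hk hT (by omega)).resolve_right (ih (by omega))
    exact h.iterate_ne_iterate hs hk hT (by omega) (by omega)
      (hs.eq_of_hasDetour hT hk (h.iterate_ne_root hs hk hT (by omega)) hmem hown
        (hasDetour_par _ hj) (h.hasDetour_iterate hs hk hT hj))

theorem iterate_mem (hj : j ≤ k) : T.par^[j] u ∈ (s (T.par^[j + 1] u)).1 :=
  (h.adj_iterate hs hk hT (by omega)).resolve_right (h.iterate_succ_notMem hs hk hT hj)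

theorem eq_of_iterate_eq (h' : CrossLink T u' v') (hj : j ≤ k) (heq : T.par^[j] u = u') :
    u = u' := by
  obtain _ | j := j
  · exact heq
  have hpar : T.par (T.par^[j] u) = u' := by rw [← heq, Function.iterate_succ_apply']
  obtain rfl : v' = T.par^[j] u :=
    hs.eq_of_hasDetour hT hk (h'.iterate_ne_root hs hk hT (Nat.zero_le _)) h'.2
      (heq ▸ h.iterate_mem hs hk hT (by omega)) (.of_par_ne h'.1.2.2)
      (heq ▸ h.hasDetour_iterate hs hk hT hj)
  exact absurd hpar h'.1.2.2

theorem eq_of_iterate_eq_iterate (h' : CrossLink T u' v') (hi : i ≤ k) (hj : j ≤ k)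
    (heq : T.par^[i] u = T.par^[j] u') : u = u' := by
  induction i generalizing j with
  | zero => exact (h'.eq_of_iterate_eq hs hk hT h hj heq.symm).symm
  | succ i ih =>
    obtain _ | j := j
    · exact h.eq_of_iterate_eq hs hk hT h' hi heq
    · refine ih (j := j) (by omega) (by omega) ?_
      exact hs.eq_of_hasDetour hT hk (h.iterate_ne_root hs hk hT (by omega))
        (h.iterate_mem hs hk hT (by omega)) (heq ▸ h'.iterate_mem hs hk hT (by omega))
        (h.hasDetour_iterate hs hk hT hi) (heq ▸ h'.hasDetour_iterate hs hk hT hj)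

end Paths

end CrossLink

section Counting

variable {V : Type*} [Fintype V] {α : ℝ} {s : Profile V} {T : BFSTree (graph s)} {x y : V} {k : ℕ}

open Classical in
theorem sum_card_cross_le (hs : IsNashEquilibrium α s) (hα : 1 < α)
    (hT : T.root ∈ (graph s).center) :
    ∑ x, #{y | T.Cross x y} ≤ 2 * #{u | ∃ v, CrossLink T u v} := by
  have card_cross_le (x : V) :
      #{y | T.Cross x y} ≤ #{y | CrossLink T x y} + #{y | CrossLink T y x} := by
    calc #{y | T.Cross x y} ≤ #{y | CrossLink T x y ∨ CrossLink T y x} :=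
          card_le_card fun y hy => by
            simp only [mem_filter_univ] at hy ⊢
            exact hy.1.symm.imp (⟨hy, ·⟩) (⟨hy.symm, ·⟩)
      _ ≤ #{y | CrossLink T x y} + #{y | CrossLink T y x} := by
        rw [filter_or]
        exact card_union_le _ _
  have card_crossLink_le (x : V) :
      #{y | CrossLink T x y} ≤ if ∃ v, CrossLink T x v then 1 else 0 := by
    split_ifs with hx
    · refine card_le_one.2 fun a ha b hb => ?_
      simp only [mem_filter_univ] at ha hb
      exact ha.eq_of_owner_eq hs (k := 0) (by simpa using hα) hT hb
    · push Not at hx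
      simp [hx]
  have sum_swap : ∑ x, #{y | CrossLink T y x} = ∑ x, #{y | CrossLink T x y} :=
    (sum_card_bipartiteAbove_eq_sum_card_bipartiteBelow (CrossLink T)).symm
  calc ∑ x, #{y | T.Cross x y} ≤ ∑ x, (#{y | CrossLink T x y} + #{y | CrossLink T y x}) :=
        sum_le_sum fun x _ => card_cross_le x
    _ = 2 * ∑ x, #{y | CrossLink T x y} := by rw [sum_add_distrib, sum_swap, two_mul]
    _ ≤ 2 * #{u | ∃ v, CrossLink T u v} := by
      rw [card_filter]
      gcongr with x
      exact card_crossLink_le x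

theorem exists_crossLink_sum_card_branches_le_one (hs : IsNashEquilibrium α s) (hk : 2 * k + 1 < α)
    (hT : T.root ∈ (graph s).center) (hxy : T.Cross x y) :
    ∃ u v, CrossLink T u v ∧ ∑ j ∈ range (k + 1), (#(T.branches (T.par^[j] u)) - 1) ≤ 1 := by
  classical
  let owners : Finset V := {u | ∃ v, CrossLink T u v}
  let paths : Finset (V × ℕ) := owners ×ˢ range (k + 1)
  have injOn : Set.InjOn (fun p : V × ℕ => T.par^[p.2] p.1) paths := by
    rintro ⟨u, i⟩ hp ⟨u', j⟩ hq heq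
    simp only [paths, owners, coe_product, Set.mem_prod, mem_coe, mem_filter_univ,
      mem_range] at hp hq heq
    obtain ⟨⟨v, hv⟩, hi⟩ := hp
    obtain ⟨⟨v', hv'⟩, hj⟩ := hq
    obtain rfl := hv.eq_of_iterate_eq_iterate hs hk hT hv' (by omega) (by omega) heq
    by_contra hne
    exact hv.iterate_ne_iterate hs hk hT (by omega) (fun hij => hne (by rw [hij])) heq
  have image_subset : paths.image (fun p => T.par^[p.2] p.1) ⊆
      ({x | T.IsBypassed x} : Finset V) := by
    intro x hx
    obtain ⟨⟨u, j⟩, hp, rfl⟩ := mem_image.1 hx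
    simp only [paths, owners, mem_product, mem_filter_univ, mem_range] at hp ⊢
    obtain ⟨⟨v, hv⟩, hj⟩ := hp
    exact hv.isBypassed_iterate hs hk hT (by omega)
  have sum_lt : ∑ u ∈ owners, ∑ j ∈ range (k + 1), (#(T.branches (T.par^[j] u)) - 1) <
      ∑ u ∈ owners, 2 := by
    calc ∑ u ∈ owners, ∑ j ∈ range (k + 1), (#(T.branches (T.par^[j] u)) - 1)
        = ∑ x ∈ paths.image (fun p => T.par^[p.2] p.1), (#(T.branches x) - 1) := by
          rw [sum_image injOn, sum_product]
      _ ≤ ∑ x with T.IsBypassed x, (#(T.branches x) - 1) := sum_le_sum_of_subset image_subset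
      _ < ∑ x, #{y | T.Cross x y} := sum_card_branches_sub_one_lt hxy
      _ ≤ 2 * #owners :=
        sum_card_cross_le hs (by linarith [k.cast_nonneg (α := ℝ)]) hT
      _ = ∑ u ∈ owners, 2 := by rw [sum_const, smul_eq_mul, mul_comm]
  obtain ⟨u, hu, hlt⟩ := exists_lt_of_sum_lt sum_lt
  obtain ⟨v, hv⟩ := (mem_filter_univ _).1 hu
  exact ⟨u, v, hv, Nat.lt_succ_iff.1 hlt⟩

end Counting

namespace BFSTree

variable {V : Type*} [Fintype V] {G : SimpleGraph V} {T : BFSTree G} {x y z : V}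

theorem par_par_ne_of_mem_branches (hx : 2 ≤ T.depth x) (hy : y ∈ T.branches x) :
    T.par (T.par x) ≠ y := by
  rintro rfl
  have := T.depth_le_depth_add_one (adj_of_mem_branches hy).symm
  rw [depth_par, depth_par] at this
  omega

theorem edist_rewire_par_par_le (hx : 2 ≤ T.depth x) (hy : y ∈ T.branches x)
    (hz : T.IsAncestor (T.par x) z) :
    (rewire G (T.par (T.par x)) {T.par x} {y}).edist (T.par (T.par x)) z ≤
      (T.depth z - T.depth (T.par x) + 3 : ℕ) := by
  have hxr : x ≠ T.root := ne_root_of_depth_pos (by omega)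
  have hpr : T.par x ≠ T.root := ne_root_of_depth_pos (by rw [depth_par]; omega)
  have depth_x := depth_eq hxr
  have depth_p := depth_eq hpr
  have ne_y := par_par_ne_of_mem_branches hx hy
  have ne_x : x ≠ T.par (T.par x) := fun h => by rw [← h] at depth_p; omega
  have edist_z := hz.edist_rewire_le (R := {T.par x}) (A := {y}) (x := T.par (T.par x)) (by omega)
  have adj_y : (rewire G (T.par (T.par x)) {T.par x} {y}).Adj (T.par (T.par x)) y :=
    rewire_adj_of_mem rfl ne_y
  have adj_x : (rewire G (T.par (T.par x)) {T.par x} {y}).Adj y x :=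
    rewire_adj_of_ne (adj_of_mem_branches hy).symm ne_y.symm ne_x
  have adj_p : (rewire G (T.par (T.par x)) {T.par x} {y}).Adj x (T.par x) :=
    rewire_adj_of_ne (T.adj_par x hxr) ne_x (T.adj_par _ hpr).ne
  generalize rewire G (T.par (T.par x)) {T.par x} {y} = H at *
  rw [SimpleGraph.edist_comm] at edist_z
  calc H.edist (T.par (T.par x)) z
      ≤ H.edist (T.par (T.par x)) (T.par x) + H.edist (T.par x) z := SimpleGraph.edist_triangle
    _ ≤ 3 + (T.depth z - T.depth (T.par x) : ℕ) :=
      add_le_add (edist_le (.cons adj_y (.cons adj_x (.cons adj_p .nil)))) edist_z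
    _ = _ := by push_cast; ring

theorem edist_rewire_par_par_add_one_le (hx : 2 ≤ T.depth x) (hxb : T.branches x = {y})
    (hpb : T.branches (T.par x) = {x}) (hz : ¬ T.IsAncestor (T.par x) z) :
    (rewire G (T.par (T.par x)) {T.par x} {y}).edist (T.par (T.par x)) z + 1 ≤
      G.edist (T.par x) z := by
  have hxr : x ≠ T.root := ne_root_of_depth_pos (by omega)
  refine edist_add_one_le_edist_of_exits (A := T.pendant (T.par x)) (B := T.pendant x) (y := y)
    (self_mem_pendant _) (fun h => hz (isAncestor_of_mem_pendant h))
    (fun h => hz ((IsAncestor.par hxr).trans (isAncestor_of_mem_pendant h))) ?_ ?_ ?_ ?_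
  · intro p hp q hqA hqB hpq
    obtain hq | hq := eq_par_or_mem_branches_of_exits_pendant hpq hp hqA
    · exact hq
    · rw [hpb, mem_singleton] at hq
      exact absurd (hq ▸ self_mem_pendant q) hqB
  · intro p hp q hqA hqB hpq
    obtain hq | hq := eq_par_or_mem_branches_of_exits_pendant hpq hp hqB
    · exact absurd (hq ▸ self_mem_pendant q) hqA
    · rwa [hxb, mem_singleton] at hq
  · intro p q hp hq hpq
    refine rewire_adj_of_forall_ne hpq fun w hw heq => ?_
    obtain rfl : w = T.par x := hw
    obtain ⟨-, rfl⟩ | ⟨-, rfl⟩ := Sym2.eq_iff.1 heq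
    exacts [hq (self_mem_pendant _), hp (self_mem_pendant _)]
  · exact rewire_adj_of_mem rfl (par_par_ne_of_mem_branches hx (by simp [hxb]))

end BFSTree

theorem IsNashEquilibrium.natEccent_par_par_lt {V : Type*} [Fintype V] {α : ℝ} {s : Profile V}
    {T : BFSTree (graph s)} {x y : V} (hs : IsNashEquilibrium α s) (hα : 0 ≤ α)
    (hT : T.root ∈ (graph s).center) (hx : 5 ≤ T.depth x)
    (hxb : T.branches x = {y}) (hpb : T.branches (T.par x) = {x})
    (hmem : T.par x ∈ (s (T.par (T.par x))).1) :
    natEccent (graph s) (T.par (T.par x)) < natEccent (graph s) (T.par x) := by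
  by_contra! hle
  -- The agent `T.par (T.par x)` would gain by trading its link to `T.par x` for one to `y`.
  have hcenter := natEccent_le_of_mem_center T.connected hT (T.par (T.par x))
  have hroot := T.depth_le_natEccent
  have hy : y ∈ T.branches x := by simp [hxb]
  obtain ⟨m, hm⟩ : ∃ m, natEccent (graph s) (T.par (T.par x)) = m + 1 :=
    Nat.exists_eq_succ_of_ne_zero (by have := hroot x; omega)
  have hrewire := hs.le_of_rewire hα (R := {T.par x}) (A := {y}) (m := m) (by simpa using hmem)
    (by simpa using par_par_ne_of_mem_branches (by omega) hy) fun z => by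
      rw [coe_singleton, coe_singleton]
      by_cases hz : T.IsAncestor (T.par x) z
      · refine (edist_rewire_par_par_le (by omega) hy hz).trans ?_
        have := hroot z
        have := hz.depth_le
        rw [depth_par] at this ⊢
        exact_mod_cast (by omega)
      · rw [← ENat.add_le_add_iff_right ENat.one_ne_top]
        exact (edist_rewire_par_par_add_one_le (by omega) hxb hpb hz).trans
          ((edist_le_natEccent T.connected _ z).trans (by exact_mod_cast hm ▸ hle))
  rw [hm] at hrewire
  simp only [card_singleton] at hrewire
  push_cast at hrewire
  linarith

namespace CrossLink

variable {V : Type*} [Fintype V] {α : ℝ} {s : Profile V} {T : BFSTree (graph s)} {u v : V} {i k : ℕ}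

theorem natEccent_iterate_lt (h : CrossLink T u v) (hs : IsNashEquilibrium α s)
    (hk : 2 * k + 1 < α) (hT : T.root ∈ (graph s).center) (hk2 : 2 ≤ k) (hi : i + 1 ≤ k)
    (h₀ : #(T.branches (T.par^[i] u)) ≤ 1) (h₁ : #(T.branches (T.par^[i + 1] u)) ≤ 1) :
    natEccent (graph s) (T.par^[i + 2] u) < natEccent (graph s) (T.par^[i + 1] u) := by
  have hbyp := h.isBypassed_iterate hs hk hT (j := i) (by omega)
  have hdepth := h.lt_depth hs hk hT
  have hmem := h.iterate_mem hs hk hT hi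
  rw [Function.iterate_succ_apply' T.par (i + 1)] at hmem ⊢
  rw [Function.iterate_succ_apply' T.par i] at h₁ hmem ⊢
  obtain ⟨y, hy⟩ := card_eq_one.1 (h₀.antisymm hbyp.branches_nonempty.card_pos)
  refine hs.natEccent_par_par_lt (by linarith [k.cast_nonneg (α := ℝ)]) hT ?_ hy ?_ hmem
  · rw [depth_iterate]
    omega
  · have hx : T.par^[i] u ∈ T.branches (T.par (T.par^[i] u)) := mem_branches.2 (.inl ⟨hbyp, rfl⟩)
    exact eq_singleton_iff_unique_mem.2 ⟨hx, fun z hz => card_le_one.1 h₁ z hz _ hx⟩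

theorem natEccent_iterate_add_one_le (h : CrossLink T u v) (hs : IsNashEquilibrium α s)
    (hk : 2 * k + 1 < α) (hT : T.root ∈ (graph s).center) (hk2 : 2 ≤ k) (hi : i + 1 ≤ k) :
    natEccent (graph s) (T.par^[i + 2] u) + 1 ≤ natEccent (graph s) (T.par^[i + 1] u) +
      2 * ((#(T.branches (T.par^[i] u)) - 1) + (#(T.branches (T.par^[i + 1] u)) - 1)) := by
  by_cases hunbranched : #(T.branches (T.par^[i] u)) ≤ 1 ∧ #(T.branches (T.par^[i + 1] u)) ≤ 1
  · have := h.natEccent_iterate_lt hs hk hT hk2 hi hunbranched.1 hunbranched.2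
    omega
  · have : natEccent (graph s) (T.par^[i + 2] u) ≤ natEccent (graph s) (T.par^[i + 1] u) + 1 :=
      natEccent_le_natEccent_add_one T.connected (h.adj_iterate hs hk hT (by omega)).symm
    rw [not_and_or] at hunbranched
    omega

theorem natEccent_iterate_add_le (h : CrossLink T u v) (hs : IsNashEquilibrium α s)
    (hk : 2 * k + 1 < α) (hT : T.root ∈ (graph s).center) (hk2 : 2 ≤ k) {n : ℕ} (hn : n ≤ k) :
    natEccent (graph s) (T.par^[n + 1] u) + n ≤ natEccent (graph s) (T.par u) +
      2 * ∑ i ∈ range n, ((#(T.branches (T.par^[i] u)) - 1) +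
        (#(T.branches (T.par^[i + 1] u)) - 1)) := by
  induction n with
  | zero => simp
  | succ n ih =>
    have step : natEccent (graph s) (T.par^[n + 1 + 1] u) + 1 ≤ _ :=
      h.natEccent_iterate_add_one_le hs hk hT hk2 hn
    have := ih (by omega)
    rw [sum_range_succ]
    omega

end CrossLink

theorem IsNashEquilibrium.not_cross {V : Type*} [Finite V] {α : ℝ} {s : Profile V}
    {T : BFSTree (graph s)} {x y : V} (hs : IsNashEquilibrium α s) (hα : 15 < α)
    (hT : T.root ∈ (graph s).center) : ¬ T.Cross x y := by
  intro hxy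
  have := Fintype.ofFinite V
  -- `7` exceeds the slack `1 + 1 + 4` left by `par_le`, `le_root` and `branching_le`.
  have hk : 2 * (7 : ℕ) + 1 < α := by norm_num; exact hα
  obtain ⟨u, v, h, branching_le⟩ := exists_crossLink_sum_card_branches_le_one hs hk hT hxy
  have descent : natEccent (graph s) (T.par^[8] u) + 7 ≤ _ :=
    h.natEccent_iterate_add_le hs hk hT (by norm_num) le_rfl
  have root_le := natEccent_le_of_mem_center T.connected hT (T.par^[8] u)
  have par_le : natEccent (graph s) (T.par u) ≤ natEccent (graph s) u + 1 :=
    natEccent_le_natEccent_add_one T.connected (h.adj_iterate hs hk hT (j := 0) (by norm_num)).symm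
  have le_root := h.natEccent_le hs (by linarith) hT
  simp only [sum_range_succ, sum_range_zero, Nat.reduceAdd] at branching_le descent
  omega

end MaxNCG

theorem theorem1_general {V : Type*} [Finite V] [Nonempty V] (α : ℝ) (hα : 15 < α)
    (G : SimpleGraph V) (hG : MaxNCG.IsEquilibriumGraph α G) : G.IsTree := by
  obtain ⟨s, hs, rfl⟩ := hG
  obtain ⟨r, hr⟩ := (MaxNCG.graph s).center_nonempty
  obtain ⟨T, rfl⟩ := MaxNCG.BFSTree.exists_root_eq hs.connected r
  exact T.isTree_of_forall_not_cross fun _ _ => hs.not_cross hα hr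

theorem theorem1 {V : Type*} [Finite V] [Nonempty V] (α : ℝ) (hα : 19 < α)
    (G : SimpleGraph V) (hG : MaxNCG.IsEquilibriumGraph α G) : G.IsTree :=
  theorem1_general α (by linarith) G hG
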